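/- Let $f:\mathbb{R}^n\to(-\infty,+\infty]$ and $g:\mathbb{R}^m\to(-\infty,+\infty]$ be proper, closed and convex, let $f$ be $\sigma$-strongly convex with $\sigma>0$, and let $A$ be a real $m\times n$ matrix. Norms are Euclidean (spectral for $A$). Put $H(x)=f(x)+g(Ax)$ and $\tilde H(x,z)=f(x)+g(z)$, and consider the problems $$(P)\quad \min_x H(x),\qquad\qquad (P')\quad \min_{x,z}\{\tilde H(x,z): Ax-z=0\}.$$ Let $q(y)=\inf_{x,z}\{\tilde H(x,z)-\langle y,Ax-z\rangle\}$ be the dual function and suppose that it has a maximizer; let $y_*$ be any maximizer. Put $F(y)=f^*(A^\top y)$, $G(y)=g^*(-y)$ (convex conjugates), $\tilde q=F+G$, $L_F=\|A\|^2/\sigma$, and for $L>0$ $$Q_L(y,w)=F(w)+\langle y-w,\nabla F(w)\rangle+\tfrac L2\|y-w\|^2+G(y),\qquad p_L(w)=\operatorname{argmin}_y Q_L(y,w).$$ Say that $L$ is admissible at $w$ if $\tilde q(p_L(w))\le Q_L(p_L(w),w)$. Let $x(y)=\operatorname{argmax}_x\{\langle A^\top y,x\rangle-f(x)\}$. At a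 point $p_L(w)$, let $z(p_L(w)):=Ax(w)+L(p_L(w)-w)$. Let $a>2$, $t_k=\frac{k+a}{a}$ and $T_k=\sum_{i=0}^k t_i$. Let $\{y_k,w_k\}$ be generated by the generalized fast dual-based proximal gradient method (GFDPG): $y_0=w_0$ is arbitrary, $L_0>0$, and for each $k\ge1$ a number $L_k\ge L_{k-1}$ admissible at $w_{k-1}$ is chosen and $$y_k=p_{L_k}(w_{k-1}),\qquad w_k=y_k+\frac{(T_{k-1}-t_{k-1})t_k}{t_{k-1}T_k}(y_k-y_{k-1})+\frac{(t_{k-1}^2-T_{k-1})t_k}{t_{k-1}T_k}(y_k-w_{k-1}).$$ In particular $z(y_i)=Ax(w_{i-1})+L_i(y_i-w_{i-1})$ for $i\ge1$. Let $k\ge1$, let $L_k'\ge L_k$ be admissible at $y_k$, and put $p=p_{L_k'}(y_k)$. Then the vectors $z(y_1),\dots,z(y_k)$ and $z(p)$ (the last one formed with $w=y_k$, $L=L_k'$) satisfy $z(y_i)\in\operatorname{argmin}_z\{\langle y_i,z\rangle+g(z)\}$ and $z(p)\in\operatorname{argmin}_z\{\langle p,z\rangle+g(z)\}$, and $$\min\Big\{\min_{1\le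 i\le k}\big[\tilde H(x(y_i),z(y_i))-q(y_i)\big],\ \tilde H(x(p),z(p))-q(p)\Big\}\le\frac{a\sqrt6}{\sqrt{a-2}}\,(L_k'+L_F)\,\big(\|y_0-y_*\|+\|y_*\|\big)\frac{\|y_0-y_*\|}{k^{1.5}}.$$ If moreover $g$ is subdifferentiable at every $z\in\mathbb{R}^m$ and $\gamma_g:=\sup\{\|d\|: z\in\mathbb{R}^m,\ d\in\partial g(z)\}<\infty$, then $$\min\Big\{\min_{1\le i\le k}\big[H(x(y_i))-q(y_i)\big],\ H(x(p))-q(p)\Big\}\le\frac{a\sqrt6}{\sqrt{a-2}}\,(L_k'+L_F)\,\big(\|y_0-y_*\|+\|y_*\|+\gamma_g\big)\frac{\|y_0-y_*\|}{k^{1.5}}.$$ -/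

import Mathlib

open scoped InnerProductSpace

noncomputable section

/-- A chosen minimizer of `φ` (unspecified when `φ` has no minimizer). -/
def argminOf {X : Type*} [Nonempty X] (φ : X → EReal) : X :=
  Classical.epsilon fun x => IsMinOn φ Set.univ x

/-- A chosen maximizer of `φ` (unspecified when `φ` has no maximizer). -/
def argmaxOf {X : Type*} [Nonempty X] (φ : X → EReal) : X :=
  Classical.epsilon fun x => IsMaxOn φ Set.univ x

section Convexity

variable {E : Type*} [NormedAddCommGroup E] [InnerProductSpace ℝ E]

/-- A function with values in `(-∞, +∞]` that is not identically `+∞`. -/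
def IsProperFun (f : E → EReal) : Prop :=
  (∀ x, f x ≠ ⊥) ∧ ∃ x, f x ≠ ⊤

/-- Convexity of a function with values in `(-∞, +∞]`. -/
def IsConvexFun (f : E → EReal) : Prop :=
  ∀ (x y : E) (a b : ℝ), 0 < a → 0 < b → a + b = 1 →
    f (a • x + b • y) ≤ (a : EReal) * f x + (b : EReal) * f y

/-- `σ`-strong convexity of a function with values in `(-∞, +∞]`. -/
def IsStronglyConvexFun (σ : ℝ) (f : E → EReal) : Prop :=
  ∀ (x y : E) (a b : ℝ), 0 < a → 0 < b → a + b = 1 →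
    f (a • x + b • y) + ((σ / 2 * a * b * ‖x - y‖ ^ 2 : ℝ) : EReal) ≤
      (a : EReal) * f x + (b : EReal) * f y

/-- The convex conjugate `f*(u) = sup_x {⟨u, x⟩ - f(x)}`. -/
def convexConj (f : E → EReal) (u : E) : EReal :=
  ⨆ x, ((⟪u, x⟫_ℝ : ℝ) : EReal) - f x

/-- The subdifferential `∂f(x)`. -/
def subdiff (f : E → EReal) (x : E) : Set E :=
  {d | ∀ u, f x + ((⟪d, u - x⟫_ℝ : ℝ) : EReal) ≤ f u}

/-- The set of norms of all subgradients of `f`, at all points. -/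
def subgradNorms (f : E → EReal) : Set ℝ :=
  {r | ∃ x, ∃ d ∈ subdiff f x, ‖d‖ = r}

/-- `f` is subdifferentiable everywhere and its subgradients are bounded. -/
def HasBoundedSubgradients (f : E → EReal) : Prop :=
  (∀ x, (subdiff f x).Nonempty) ∧ BddAbove (subgradNorms f)

/-- `γ_f`, the supremum of the norms of the subgradients of `f`. -/
def subgradBound (f : E → EReal) : ℝ :=
  sSup (subgradNorms f)

end Convexity

section Duality

variable {E V : Type*} [NormedAddCommGroup E] [InnerProductSpace ℝ E] [CompleteSpace E]
  [NormedAddCommGroup V] [InnerProductSpace ℝ V] [CompleteSpace V]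

/-- The primal objective `H(x) = f(x) + g(Ax)`. -/
def primalObj (f : E → EReal) (g : V → EReal) (A : E →L[ℝ] V) (x : E) : EReal :=
  f x + g (A x)

/-- The objective `f(x) + g(z)` of the split problem, whose constraint is `Ax - z = 0`. -/
def splitObj (f : E → EReal) (g : V → EReal) (x : E) (z : V) : EReal :=
  f x + g z

/-- The dual function `q(y) = inf_{x,z} {f(x) + g(z) - ⟨y, Ax - z⟩}`. -/
def dualFun (f : E → EReal) (g : V → EReal) (A : E →L[ℝ] V) (y : V) : EReal :=
  ⨅ (x : E) (z : V), splitObj f g x z - ((⟪y, A x - z⟫_ℝ : ℝ) : EReal)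

/-- `F(y) = f*(Aᵀy)`. -/
def dualF (f : E → EReal) (A : E →L[ℝ] V) (y : V) : EReal :=
  convexConj f (ContinuousLinearMap.adjoint A y)

/-- `G(y) = g*(-y)`. -/
def dualG (g : V → EReal) (y : V) : EReal :=
  convexConj g (-y)

/-- `F(y) + G(y)`, the objective of the dual problem as a minimization problem. -/
def dualObj (f : E → EReal) (g : V → EReal) (A : E →L[ℝ] V) (y : V) : EReal :=
  dualF f A y + dualG g y

/-- `∇F(y)`; `F` is finite everywhere when `f` is proper, closed and strongly convex. -/
def gradF (f : E → EReal) (A : E →L[ℝ] V) (y : V) : V :=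
  gradient (fun v => (dualF f A v).toReal) y

/-- The quadratic model
`Q_L(y, w) = F(w) + ⟨y - w, ∇F(w)⟩ + (L/2)‖y - w‖² + G(y)`. -/
def quadModel (f : E → EReal) (g : V → EReal) (A : E →L[ℝ] V) (L : ℝ) (y w : V) : EReal :=
  dualF f A w + ((⟪y - w, gradF f A w⟫_ℝ + L / 2 * ‖y - w‖ ^ 2 : ℝ) : EReal) + dualG g y

/-- The proximal gradient update `p_L(w) = argmin_y Q_L(y, w)`. -/
def proxGrad (f : E → EReal) (g : V → EReal) (A : E →L[ℝ] V) (L : ℝ) (w : V) : V :=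
  argminOf fun y => quadModel f g A L y w

/-- The backtracking condition `(F + G)(p_L(w)) ≤ Q_L(p_L(w), w)`. -/
def BacktrackCond (f : E → EReal) (g : V → EReal) (A : E →L[ℝ] V) (L : ℝ) (w : V) : Prop :=
  dualObj f g A (proxGrad f g A L w) ≤ quadModel f g A L (proxGrad f g A L w) w

/-- The primal vector `x(y) = argmax_x {⟨Aᵀy, x⟩ - f(x)}`. -/
def primalX (f : E → EReal) (A : E →L[ℝ] V) (y : V) : E :=
  argmaxOf fun x => ((⟪ContinuousLinearMap.adjoint A y, x⟫_ℝ : ℝ) : EReal) - f x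

/-- `z` is a valid choice of the primal vector `z(y) ∈ argmin_z {⟨y, z⟩ + g(z)}`. -/
def IsPrimalZ (g : V → EReal) (y z : V) : Prop :=
  IsMinOn (fun z => ((⟪y, z⟫_ℝ : ℝ) : EReal) + g z) Set.univ z

/-- The choice of `z(p_L(w))` that comes with the update `p_L(w)`: the vector `z` with
`A x(w) - z + L (p_L(w) - w) = 0`. -/
def proxZ (f : E → EReal) (g : V → EReal) (A : E →L[ℝ] V) (L : ℝ) (w : V) : V :=
  A (primalX f A w) + L • (proxGrad f g A L w - w)

/-- `T_k = t_0 + ⋯ + t_k`. -/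
def partialT (t : ℕ → ℝ) (k : ℕ) : ℝ :=
  ∑ i ∈ Finset.range (k + 1), t i

/-- `{y_k, w_k}` is generated by the generalized fast dual-based proximal gradient method with
backtracking, with parameters `t_k` and constants `L_k`. -/
structure IsGFDPG (f : E → EReal) (g : V → EReal) (A : E →L[ℝ] V)
    (t L : ℕ → ℝ) (y w : ℕ → V) : Prop where
  w_zero : w 0 = y 0
  L_zero_pos : 0 < L 0
  t_zero : 0 < t 0 ∧ t 0 ≤ 1
  L_le : ∀ k, L k ≤ L (k + 1)
  backtrack : ∀ k, BacktrackCond f g A (L (k + 1)) (w k)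
  y_succ : ∀ k, y (k + 1) = proxGrad f g A (L (k + 1)) (w k)
  t_pos : ∀ k, 0 < t (k + 1)
  t_sq_le : ∀ k, t (k + 1) ^ 2 ≤ partialT t (k + 1)
  w_succ : ∀ k, w (k + 1) = y (k + 1)
    + ((partialT t k - t k) * t (k + 1) / (t k * partialT t (k + 1))) • (y (k + 1) - y k)
    + ((t k ^ 2 - partialT t k) * t (k + 1) / (t k * partialT t (k + 1))) • (y (k + 1) - w k)

end Duality

end

/-!
Up to sign `q` is `F + G`, and strong convexity of `f` makes `F` differentiable with
`∇F(w) = A x(w)` and `‖∇F(v) - ∇F(w)‖ ≤ (‖A‖² / σ) ‖v - w‖`. The optimality condition of the update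
`p = p_L(w)` reads `-p ∈ ∂g(z(p))` with `z(p) = ∇F(w) + L (p - w)`. By the Fenchel equalities at
`x(p)` and `z(p)` the duality gap at `p` equals `⟨p, A x(p) - z(p)⟩`, where
`‖A x(p) - z(p)‖ = ‖∇F(p) - ∇F(w) - L (p - w)‖ ≤ (L + ‖A‖² / σ) ‖p - w‖`; so the gap is small as
soon as `p` is bounded and the step from `w` to `p` is short. Replacing `z(p)` by `A x(p)` in `g`
costs at most `γ_g ‖A x(p) - z(p)‖`.

A short step exists by averaging. With `S_k = t_0 + ⋯ + t_{k-1}` and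
`u_k = y_0 + ∑_{i < k} t_i (y_{i+1} - w_i)`, the point `w_k` is the average of `y_k` and `u_k` with
weights `S_k` and `t_k`, and the potential
`∑_{i < k} (T_i - t_i²) ‖y_{i+1} - w_i‖² + ‖u_k - y_*‖² + 2 S_k (q(y_*) - q(y_k)) / L_k`
is nonincreasing in `k`. One further step from `y_k` to `p` decreases `-q` by at least
`L' ‖p - y_k‖² / 2`, so the squared step lengths have weighted sum at most `‖y_0 - y_*‖²`. For
`t_i = (i + a) / a` the total weight is of order `k³`, which is where the exponent `1.5` comes from.
-/

open Filter Topology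

section Subgradients

variable {E : Type*} [NormedAddCommGroup E] [InnerProductSpace ℝ E] {φ : E → EReal} {x u : E}

theorem mem_subdiff_iff_isMinOn :
    u ∈ subdiff φ x ↔ IsMinOn (fun v => φ v + ((-⟪u, v⟫_ℝ : ℝ) : EReal)) Set.univ x := by
  rw [isMinOn_univ_iff]
  refine forall_congr' fun v => ?_
  rw [← (EReal.addLECancellable_coe (-⟪u, v⟫_ℝ)).add_le_add_iff_right, add_assoc,
    ← EReal.coe_add, inner_sub_right, sub_add_eq_add_sub, add_neg_cancel, zero_sub]

theorem mem_subdiff_iff_isMaxOn :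
    u ∈ subdiff φ x ↔ IsMaxOn (fun v => ((⟪u, v⟫_ℝ : ℝ) : EReal) - φ v) Set.univ x := by
  have hneg (v : E) :
      φ v + ((-⟪u, v⟫_ℝ : ℝ) : EReal) = -(((⟪u, v⟫_ℝ : ℝ) : EReal) - φ v) := by
    rw [EReal.neg_sub (Or.inl (EReal.coe_ne_bot _)) (Or.inl (EReal.coe_ne_top _)), EReal.coe_neg,
      add_comm]
  simp only [mem_subdiff_iff_isMinOn, isMinOn_univ_iff, isMaxOn_univ_iff, hneg,
    EReal.neg_le_neg_iff]

theorem isPrimalZ_iff_neg_mem_subdiff {y z : E} : IsPrimalZ φ y z ↔ -y ∈ subdiff φ z := by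
  simp only [IsPrimalZ, mem_subdiff_iff_isMinOn, inner_neg_left, neg_neg, add_comm]

theorem IsProperFun.exists_eq_coe_of_mem_subdiff (hφ : IsProperFun φ) (hu : u ∈ subdiff φ x) :
    ∃ r : ℝ, φ x = r := by
  obtain ⟨hbot, v, hv⟩ := hφ
  have hx : φ x ≠ ⊤ := fun h => hv (top_le_iff.1 (by simpa [h] using hu v))
  exact ⟨_, (EReal.coe_toReal hx (hbot x)).symm⟩

theorem convexConj_eq_of_mem_subdiff (hu : u ∈ subdiff φ x) :
    convexConj φ u = ((⟪u, x⟫_ℝ : ℝ) : EReal) - φ x :=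
  (iSup_le (isMaxOn_univ_iff.1 (mem_subdiff_iff_isMaxOn.1 hu))).antisymm
    (le_iSup (fun v => ((⟪u, v⟫_ℝ : ℝ) : EReal) - φ v) x)

theorem mem_subdiff_convexConj (hu : u ∈ subdiff φ x) : x ∈ subdiff (convexConj φ) u := by
  intro v
  rw [convexConj_eq_of_mem_subdiff hu]
  refine le_trans (le_of_eq ?_) (le_iSup (fun z => ((⟪v, z⟫_ℝ : ℝ) : EReal) - φ z) x)
  have hinner : ⟪v, x⟫_ℝ = ⟪u, x⟫_ℝ + ⟪x, v - u⟫_ℝ := by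
    rw [inner_sub_right, real_inner_comm v, real_inner_comm u]; ring
  rw [hinner, EReal.coe_add, sub_eq_add_neg _ (φ x), sub_eq_add_neg _ (φ x), add_right_comm]

theorem IsProperFun.convexConj_ne_bot (hφ : IsProperFun φ) (u : E) : convexConj φ u ≠ ⊥ := by
  obtain ⟨hbot, x, hx⟩ := hφ
  lift φ x to ℝ using ⟨hx, hbot x⟩ with r hr
  refine ((EReal.bot_lt_coe (⟪u, x⟫_ℝ - r)).trans_le ?_).ne'
  exact le_iSup_of_le x (by rw [← hr, EReal.coe_sub])

theorem IsProperFun.add_convexConj_eq_inner (hφ : IsProperFun φ) (hu : u ∈ subdiff φ x) :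
    φ x + convexConj φ u = ((⟪u, x⟫_ℝ : ℝ) : EReal) := by
  obtain ⟨r, hr⟩ := hφ.exists_eq_coe_of_mem_subdiff hu
  rw [convexConj_eq_of_mem_subdiff hu, hr, ← EReal.coe_sub, ← EReal.coe_add, add_sub_cancel]

theorem subgradBound_nonneg (φ : E → EReal) : 0 ≤ subgradBound φ :=
  Real.sSup_nonneg <| by
    rintro _ ⟨x, d, -, rfl⟩
    exact norm_nonneg d

end Subgradients

section StrongConvexity

variable {E : Type*} [NormedAddCommGroup E] [InnerProductSpace ℝ E] {φ : E → EReal} {σ : ℝ}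

theorem IsConvexFun.isStronglyConvexFun_zero (hφ : IsConvexFun φ) : IsStronglyConvexFun 0 φ :=
  fun x y a b ha hb hab => by simpa using hφ x y a b ha hb hab

theorem IsStronglyConvexFun.add_le_of_coe_le (hφ : IsStronglyConvexFun σ φ) {x y : E}
    {a b r s m : ℝ} (hx : φ x ≤ r) (hy : φ y ≤ s) (ha : 0 < a) (hb : 0 < b) (hab : a + b = 1)
    (hm : (m : EReal) ≤ φ (a • x + b • y)) :
    m + σ / 2 * a * b * ‖x - y‖ ^ 2 ≤ a * r + b * s := by
  rw [← EReal.coe_le_coe_iff, EReal.coe_add, EReal.coe_add (a * r), EReal.coe_mul a,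
    EReal.coe_mul b]
  calc (m : EReal) + ((σ / 2 * a * b * ‖x - y‖ ^ 2 : ℝ) : EReal)
      ≤ φ (a • x + b • y) + ((σ / 2 * a * b * ‖x - y‖ ^ 2 : ℝ) : EReal) := by gcongr
    _ ≤ a * φ x + b * φ y := hφ x y a b ha hb hab
    _ ≤ a * r + b * s := by gcongr

theorem IsStronglyConvexFun.add_norm_sq_le_of_mem_subdiff (hφ : IsStronglyConvexFun σ φ)
    {x u : E} (hu : u ∈ subdiff φ x) (v : E) :
    φ x + ((⟪u, v - x⟫_ℝ + σ / 2 * ‖v - x‖ ^ 2 : ℝ) : EReal) ≤ φ v := by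
  have huv := hu v
  induction hx : φ x with
  | bot => simp
  | top =>
    rw [hx, EReal.top_add_coe, top_le_iff] at huv
    rw [huv]
    exact le_top
  | coe r =>
    induction hv : φ v with
    | bot => simp [hx, hv, ← EReal.coe_add] at huv
    | top => simp
    | coe s =>
      have hsegment : ∀ᶠ b : ℝ in 𝓝[>] 0,
          r + ⟪u, v - x⟫_ℝ + σ / 2 * (1 - b) * ‖v - x‖ ^ 2 ≤ s := by
        filter_upwards [Ioo_mem_nhdsGT one_pos] with b ⟨hb, hb1⟩
        have hpoint : (1 - b) • x + b • v - x = b • (v - x) := by module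
        have hsub : ((r + b * ⟪u, v - x⟫_ℝ : ℝ) : EReal) ≤ φ ((1 - b) • x + b • v) := by
          simpa only [hx, hpoint, inner_smul_right, EReal.coe_add] using hu ((1 - b) • x + b • v)
        have hconv := hφ.add_le_of_coe_le hx.le hv.le (sub_pos.2 hb1) hb (sub_add_cancel 1 b) hsub
        rw [norm_sub_rev] at hconv
        refine le_of_mul_le_mul_left ?_ hb
        linarith
      have hlim : Tendsto (fun b : ℝ => r + ⟪u, v - x⟫_ℝ + σ / 2 * (1 - b) * ‖v - x‖ ^ 2)
          (𝓝[>] 0) (𝓝 (r + ⟪u, v - x⟫_ℝ + σ / 2 * (1 - 0) * ‖v - x‖ ^ 2)) :=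
        (Continuous.tendsto (by fun_prop) 0).mono_left nhdsWithin_le_nhds
      have hle := le_of_tendsto hlim hsegment
      rw [← EReal.coe_add, EReal.coe_le_coe_iff]
      linarith

theorem IsStronglyConvexFun.mul_norm_sub_sq_le_inner (hφ : IsStronglyConvexFun σ φ)
    (hp : IsProperFun φ) {x y u v : E} (hu : u ∈ subdiff φ x) (hv : v ∈ subdiff φ y) :
    σ * ‖x - y‖ ^ 2 ≤ ⟪u - v, x - y⟫_ℝ := by
  obtain ⟨r, hr⟩ := hp.exists_eq_coe_of_mem_subdiff hu
  obtain ⟨s, hs⟩ := hp.exists_eq_coe_of_mem_subdiff hv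
  have hxy := hφ.add_norm_sq_le_of_mem_subdiff hu y
  have hyx := hφ.add_norm_sq_le_of_mem_subdiff hv x
  rw [hr, hs, ← EReal.coe_add, EReal.coe_le_coe_iff] at hxy hyx
  rw [norm_sub_rev, ← neg_sub x y, inner_neg_right] at hxy
  rw [inner_sub_left]
  linarith

theorem IsStronglyConvexFun.mul_norm_sub_le_norm_sub (hφ : IsStronglyConvexFun σ φ)
    (hp : IsProperFun φ) {x y u v : E} (hu : u ∈ subdiff φ x) (hv : v ∈ subdiff φ y) :
    σ * ‖x - y‖ ≤ ‖u - v‖ := by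
  rcases (norm_nonneg (x - y)).eq_or_lt with h0 | hpos
  · rw [← h0, mul_zero]; exact norm_nonneg _
  · refine le_of_mul_le_mul_right ?_ hpos
    calc σ * ‖x - y‖ * ‖x - y‖ = σ * ‖x - y‖ ^ 2 := by ring
      _ ≤ ⟪u - v, x - y⟫_ℝ := hφ.mul_norm_sub_sq_le_inner hp hu hv
      _ ≤ ‖u - v‖ * ‖x - y‖ := real_inner_le_norm _ _

theorem IsStronglyConvexFun.coe_le_of_forall_dist_lt (hφ : IsStronglyConvexFun σ φ) (hσ : 0 < σ)
    {x₀ : E} {c ρ : ℝ} (hρ : 0 < ρ) (hc : φ x₀ ≤ c)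
    (hball : ∀ v, dist v x₀ < ρ → ((c - 1 : ℝ) : EReal) ≤ φ v) (v : E) :
    ((c - 1 - 4 / (σ * ρ ^ 2) : ℝ) : EReal) ≤ φ v := by
  rcases lt_or_ge (dist v x₀) ρ with hnear | hfar
  · exact (EReal.coe_le_coe_iff.2 (sub_le_self _ (by positivity))).trans (hball v hnear)
  by_contra! hlt
  rw [dist_eq_norm] at hfar
  set n := ‖v - x₀‖ with hn
  have hn0 : 0 < n := hρ.trans_le hfar
  -- The point of the segment `[x₀, v]` at distance `ρ / 2` from `x₀`.
  set b := ρ / (2 * n) with hb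
  have hb0 : 0 < b := by positivity
  have hb1 : b ≤ 1 / 2 := by rw [hb, div_le_div_iff₀ (by positivity) two_pos]; linarith
  have hmem : dist ((1 - b) • x₀ + b • v) x₀ < ρ := by
    have hpoint : (1 - b) • x₀ + b • v - x₀ = b • (v - x₀) := by module
    have hbn : b * n = ρ / 2 := by rw [hb]; field_simp
    rw [dist_eq_norm, hpoint, norm_smul, ← hn, Real.norm_of_nonneg hb0.le, hbn]
    exact half_lt_self hρ
  have hconv := hφ.add_le_of_coe_le hc hlt.le (by linarith) hb0 (sub_add_cancel 1 b)
    (hball _ hmem)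
  rw [norm_sub_rev, ← hn] at hconv
  have hgrowth : c - 2 * n / ρ + σ / 4 * n ^ 2 ≤ c - 1 - 4 / (σ * ρ ^ 2) := by
    refine le_of_mul_le_mul_left ?_ hb0
    have hone : b * (2 * n / ρ) = 1 := by rw [hb]; field_simp
    have hhalf : b * (σ / 4 * n ^ 2) ≤ σ / 2 * (1 - b) * b * n ^ 2 := by
      have hpos : 0 ≤ σ / 2 * b * n ^ 2 := by positivity
      nlinarith
    linarith
  have hsq : σ / 4 * n ^ 2 - 2 * n / ρ + 4 / (σ * ρ ^ 2) = σ / 4 * (n - 4 / (σ * ρ)) ^ 2 := by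
    field_simp
    ring
  have hsq0 : 0 ≤ σ / 4 * (n - 4 / (σ * ρ)) ^ 2 := by positivity
  linarith

/-- Proper, lower semicontinuous, `σ`-strongly convex functions; `σ = 0` gives the proper closed
convex functions. -/
structure IsClosedProperStronglyConvex (σ : ℝ) (φ : E → EReal) : Prop where
  proper : IsProperFun φ
  closed : LowerSemicontinuous φ
  stronglyConvex : IsStronglyConvexFun σ φ

namespace IsClosedProperStronglyConvex

theorem add_coe (hφ : IsClosedProperStronglyConvex σ φ) {τ : ℝ} {h : E → ℝ}
    (hh : StrongConvexOn Set.univ τ h) (hcont : Continuous h) :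
    IsClosedProperStronglyConvex (σ + τ) (fun x => φ x + (h x : EReal)) where
  proper := by
    obtain ⟨hbot, x, hx⟩ := hφ.proper
    exact ⟨fun x => by simp [EReal.add_eq_bot_iff, hbot], x,
      EReal.add_ne_top hx (EReal.coe_ne_top _)⟩
  closed :=
    hφ.closed.add' (continuous_coe_real_ereal.comp hcont).lowerSemicontinuous fun _ =>
      EReal.continuousAt_add (Or.inr (EReal.coe_ne_bot _)) (Or.inr (EReal.coe_ne_top _))
  stronglyConvex x y a b ha hb hab := by
    have hdistrib {c : ℝ} (hc : 0 < c) (z : E) :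
        (c : EReal) * (φ z + (h z : EReal)) = c * φ z + ((c * h z : ℝ) : EReal) := by
      rw [EReal.left_distrib_of_nonneg_of_ne_top (EReal.coe_nonneg.2 hc.le) (EReal.coe_ne_top _),
        EReal.coe_mul]
    have hreal : h (a • x + b • y) + τ / 2 * a * b * ‖x - y‖ ^ 2 ≤ a * h x + b * h y := by
      have := hh.2 (Set.mem_univ x) (Set.mem_univ y) ha.le hb.le hab
      simp only [smul_eq_mul] at this
      linarith
    have hsplit : (σ + τ) / 2 * a * b * ‖x - y‖ ^ 2 =
        σ / 2 * a * b * ‖x - y‖ ^ 2 + τ / 2 * a * b * ‖x - y‖ ^ 2 := by ring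
    have hsum := add_le_add (hφ.stronglyConvex x y a b ha hb hab) (EReal.coe_le_coe_iff.2 hreal)
    rw [hdistrib ha, hdistrib hb, hsplit, EReal.coe_add, add_add_add_comm, ← EReal.coe_add,
      add_add_add_comm (_ * φ x), ← EReal.coe_add]
    exact hsum

theorem exists_coe_le (hφ : IsClosedProperStronglyConvex σ φ) (hσ : 0 < σ) :
    ∃ m : ℝ, ∀ x, (m : EReal) ≤ φ x := by
  obtain ⟨hbot, x₀, hx₀⟩ := hφ.proper
  obtain ⟨c, hc⟩ : ∃ c : ℝ, φ x₀ = c := ⟨_, (EReal.coe_toReal hx₀ (hbot x₀)).symm⟩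
  have hlt : ((c - 1 : ℝ) : EReal) < φ x₀ := by
    rw [hc, EReal.coe_lt_coe_iff]
    exact sub_one_lt c
  obtain ⟨ρ, hρ, hball⟩ := Metric.eventually_nhds_iff.1 (hφ.closed x₀ _ hlt)
  exact ⟨_, hφ.stronglyConvex.coe_le_of_forall_dist_lt hσ hρ hc.le fun v hv => (hball hv).le⟩

theorem exists_isGLB_range_coe (hφ : IsClosedProperStronglyConvex σ φ) (hσ : 0 < σ) :
    ∃ m : ℝ, IsGLB (Set.range φ) m := by
  obtain ⟨c, hc⟩ := hφ.exists_coe_le hσ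
  obtain ⟨x₀, hx₀⟩ := hφ.proper.2
  have hbot : ⨅ x, φ x ≠ ⊥ := ((EReal.bot_lt_coe c).trans_le (le_iInf hc)).ne'
  have htop : ⨅ x, φ x ≠ ⊤ := ((iInf_le φ x₀).trans_lt hx₀.lt_top).ne
  refine ⟨(⨅ x, φ x).toReal, ?_⟩
  rw [EReal.coe_toReal htop hbot]
  exact isGLB_iInf

theorem exists_isMinOn [CompleteSpace E] (hφ : IsClosedProperStronglyConvex σ φ) (hσ : 0 < σ) :
    ∃ x, IsMinOn φ Set.univ x := by
  obtain ⟨m, hglb⟩ := hφ.exists_isGLB_range_coe hσ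
  have hm (v : E) : (m : EReal) ≤ φ v := hglb.1 (Set.mem_range_self v)
  have happrox (N : ℕ) : ∃ x, φ x < ((m + 1 / ((N : ℝ) + 1) : ℝ) : EReal) := by
    obtain ⟨-, ⟨x, rfl⟩, -, hx⟩ := hglb.exists_between
      (EReal.coe_lt_coe_iff.2 (lt_add_of_pos_right m (Nat.one_div_pos_of_nat (n := N))))
    exact ⟨x, hx⟩
  choose x hx using happrox
  have hle {N i : ℕ} (hi : N ≤ i) : φ (x i) ≤ ((m + 1 / ((N : ℝ) + 1) : ℝ) : EReal) :=
    (hx i).le.trans (EReal.coe_le_coe_iff.2 (by gcongr))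
  have hdist (i j N : ℕ) (hi : N ≤ i) (hj : N ≤ j) :
      dist (x i) (x j) ≤ √(8 / σ * (1 / ((N : ℝ) + 1))) := by
    have hmid := hφ.stronglyConvex.add_le_of_coe_le (hle hi) (hle hj) one_half_pos one_half_pos
      (add_halves 1) (hm _)
    rw [dist_eq_norm]
    refine Real.le_sqrt_of_sq_le ?_
    rw [div_mul_eq_mul_div, le_div_iff₀ hσ]
    linarith
  have hlim : Tendsto (fun N : ℕ => √(8 / σ * (1 / ((N : ℝ) + 1)))) atTop (𝓝 0) := by
    simpa using (tendsto_one_div_add_atTop_nhds_zero_nat.const_mul (8 / σ)).sqrt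
  obtain ⟨x₀, hx₀⟩ := cauchySeq_tendsto_of_complete (cauchySeq_of_le_tendsto_0 _ hdist hlim)
  refine ⟨x₀, isMinOn_univ_iff.2 fun v => le_trans ?_ (hm v)⟩
  have hsublevel (N : ℕ) : φ x₀ ≤ ((m + 1 / ((N : ℝ) + 1) : ℝ) : EReal) :=
    (hφ.closed.isClosed_preimage _).mem_of_tendsto hx₀
      (eventually_atTop.2 ⟨N, fun i hi => hle hi⟩)
  have hvalue : Tendsto (fun N : ℕ => ((m + 1 / ((N : ℝ) + 1) : ℝ) : EReal)) atTop (𝓝 m) := by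
    refine (continuous_coe_real_ereal.tendsto m).comp ?_
    simpa using tendsto_one_div_add_atTop_nhds_zero_nat.const_add m
  exact ge_of_tendsto' hvalue hsublevel

theorem exists_mem_subdiff [CompleteSpace E] (hφ : IsClosedProperStronglyConvex σ φ) (hσ : 0 < σ)
    (u : E) : ∃ x, u ∈ subdiff φ x := by
  have hlin : StrongConvexOn Set.univ 0 fun x => -⟪u, x⟫_ℝ :=
    strongConvexOn_zero.2 ((-innerSL ℝ u).toLinearMap.convexOn convex_univ)
  simp only [mem_subdiff_iff_isMinOn]
  exact (hφ.add_coe hlin (by fun_prop)).exists_isMinOn (by rwa [add_zero])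

theorem exists_sub_smul_mem_subdiff [CompleteSpace E] (hφ : IsClosedProperStronglyConvex 0 φ)
    {c : ℝ} (hc : 0 < c) (u : E) : ∃ x, u - c • x ∈ subdiff φ x := by
  have hquad : StrongConvexOn Set.univ c fun x : E => c / 2 * ‖x‖ ^ 2 := by
    rw [strongConvexOn_iff_convex]
    simpa using convexOn_const 0 convex_univ
  have hsum := hφ.add_coe hquad (by fun_prop)
  rw [zero_add] at hsum
  obtain ⟨x, hx⟩ := hsum.exists_mem_subdiff hc u
  refine ⟨x, fun v => ?_⟩
  have hv := hsum.stronglyConvex.add_norm_sq_le_of_mem_subdiff hx v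
  rw [add_assoc, ← EReal.coe_add] at hv
  refine (EReal.addLECancellable_coe (c / 2 * ‖v‖ ^ 2)).add_le_add_iff_right.1 (hv.trans' ?_)
  have hexpand : ⟪u - c • x, v - x⟫_ℝ + c / 2 * ‖v‖ ^ 2 =
      c / 2 * ‖x‖ ^ 2 + (⟪u, v - x⟫_ℝ + c / 2 * ‖v - x‖ ^ 2) := by
    rw [norm_sub_sq_real, inner_sub_left, inner_smul_left, inner_sub_right x,
      real_inner_self_eq_norm_sq, real_inner_comm v x]
    simp only [conj_trivial]
    ring
  rw [add_assoc, ← EReal.coe_add, hexpand]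

end IsClosedProperStronglyConvex

end StrongConvexity

theorem hasGradientAt_of_continuousAt_subgradient {V : Type*} [NormedAddCommGroup V]
    [InnerProductSpace ℝ V] [CompleteSpace V] {F : V → ℝ} {G : V → V} {w : V}
    (hFG : ∀ v w, F w + ⟪G w, v - w⟫_ℝ ≤ F v) (hG : ContinuousAt G w) :
    HasGradientAt F (G w) w := by
  rw [hasGradientAt_iff_isLittleO]
  refine Asymptotics.isLittleO_iff.2 fun ε hε => ?_
  filter_upwards [Metric.continuousAt_iff'.1 hG ε hε] with v hv
  have hlower := hFG v w
  have hupper := hFG w v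
  rw [← neg_sub v w, inner_neg_right] at hupper
  rw [Real.norm_of_nonneg (by linarith)]
  calc F v - F w - ⟪G w, v - w⟫_ℝ ≤ ⟪G v - G w, v - w⟫_ℝ := by rw [inner_sub_left]; linarith
    _ ≤ ‖G v - G w‖ * ‖v - w‖ := real_inner_le_norm _ _
    _ ≤ ε * ‖v - w‖ := by rw [← dist_eq_norm (G v)]; gcongr

section DualProblem

variable {E V : Type*} [NormedAddCommGroup E] [InnerProductSpace ℝ E] [CompleteSpace E]
  [NormedAddCommGroup V] [InnerProductSpace ℝ V] [CompleteSpace V]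
  {f : E → EReal} {g : V → EReal} {A : E →L[ℝ] V} {σ : ℝ}

theorem map_mem_subdiff_dualF {x : E} {w : V}
    (hx : ContinuousLinearMap.adjoint A w ∈ subdiff f x) : A x ∈ subdiff (dualF f A) w := by
  intro v
  have hv := mem_subdiff_convexConj hx (ContinuousLinearMap.adjoint A v)
  rwa [← map_sub, ContinuousLinearMap.adjoint_inner_right] at hv

omit [CompleteSpace V] in
theorem neg_mem_subdiff_dualG {p z : V} (hz : -p ∈ subdiff g z) : -z ∈ subdiff (dualG g) p := by
  intro v
  have hv := mem_subdiff_convexConj hz (-v)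
  rwa [← neg_sub', inner_neg_right, ← inner_neg_left] at hv

theorem adjoint_mem_subdiff_primalX (hf : IsClosedProperStronglyConvex σ f) (hσ : 0 < σ)
    (A : E →L[ℝ] V) (y : V) : ContinuousLinearMap.adjoint A y ∈ subdiff f (primalX f A y) := by
  obtain ⟨x, hx⟩ := hf.exists_mem_subdiff hσ (ContinuousLinearMap.adjoint A y)
  exact mem_subdiff_iff_isMaxOn.2 (Classical.epsilon_spec ⟨x, mem_subdiff_iff_isMaxOn.1 hx⟩)

theorem coe_toReal_dualF (hf : IsClosedProperStronglyConvex σ f) (hσ : 0 < σ)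
    (A : E →L[ℝ] V) (y : V) : ((dualF f A y).toReal : EReal) = dualF f A y := by
  have hx := adjoint_mem_subdiff_primalX hf hσ A y
  obtain ⟨r, hr⟩ := hf.proper.exists_eq_coe_of_mem_subdiff hx
  rw [dualF, convexConj_eq_of_mem_subdiff hx, hr, ← EReal.coe_sub, EReal.toReal_coe]

theorem norm_map_primalX_sub_le (hf : IsClosedProperStronglyConvex σ f) (hσ : 0 < σ)
    (A : E →L[ℝ] V) (v w : V) :
    ‖A (primalX f A v) - A (primalX f A w)‖ ≤ ‖A‖ ^ 2 / σ * ‖v - w‖ := by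
  have hmono := hf.stronglyConvex.mul_norm_sub_le_norm_sub hf.proper
    (adjoint_mem_subdiff_primalX hf hσ A v) (adjoint_mem_subdiff_primalX hf hσ A w)
  have hadjoint : ‖ContinuousLinearMap.adjoint A (v - w)‖ ≤ ‖A‖ * ‖v - w‖ := by
    simpa only [LinearIsometryEquiv.norm_map] using
      (ContinuousLinearMap.adjoint A).le_opNorm (v - w)
  rw [← map_sub, mul_comm] at hmono
  calc ‖A (primalX f A v) - A (primalX f A w)‖
      ≤ ‖A‖ * ‖primalX f A v - primalX f A w‖ := by rw [← map_sub]; exact A.le_opNorm _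
    _ ≤ ‖A‖ * (‖A‖ * ‖v - w‖ / σ) := by
      gcongr
      exact (le_div_iff₀ hσ).2 (hmono.trans hadjoint)
    _ = ‖A‖ ^ 2 / σ * ‖v - w‖ := by ring

theorem gradF_eq (hf : IsClosedProperStronglyConvex σ f) (hσ : 0 < σ) (A : E →L[ℝ] V) (w : V) :
    gradF f A w = A (primalX f A w) := by
  have hlip : LipschitzWith (Real.toNNReal (‖A‖ ^ 2 / σ)) fun v => A (primalX f A v) :=
    LipschitzWith.of_dist_le' fun v w => by
      simpa only [dist_eq_norm] using norm_map_primalX_sub_le hf hσ A v w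
  refine (hasGradientAt_of_continuousAt_subgradient (G := fun v => A (primalX f A v))
    (fun v w => ?_) hlip.continuous.continuousAt).gradient
  rw [← EReal.coe_le_coe_iff, EReal.coe_add, coe_toReal_dualF hf hσ, coe_toReal_dualF hf hσ]
  exact map_mem_subdiff_dualF (adjoint_mem_subdiff_primalX hf hσ A w) v

theorem dualFun_eq_neg_dualObj (hf : IsProperFun f) (hg : IsProperFun g) (A : E →L[ℝ] V) (y : V) :
    dualFun f g A y = -dualObj f g A y := by
  have hterm (x : E) (z : V) :
      (((⟪ContinuousLinearMap.adjoint A y, x⟫_ℝ : ℝ) : EReal) - f x)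
        + (((⟪-y, z⟫_ℝ : ℝ) : EReal) - g z)
      = -(splitObj f g x z - ((⟪y, A x - z⟫_ℝ : ℝ) : EReal)) := by
    rw [splitObj, EReal.neg_sub (Or.inr (EReal.coe_ne_bot _)) (Or.inr (EReal.coe_ne_top _)),
      EReal.neg_add (Or.inl (hf.1 x)) (Or.inr (hg.1 z)), ContinuousLinearMap.adjoint_inner_left,
      inner_sub_right, inner_neg_left, sub_eq_add_neg ⟪y, A x⟫_ℝ, EReal.coe_add]
    simp only [sub_eq_add_neg]
    ac_rfl
  refine le_antisymm ?_ ?_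
  · rw [EReal.le_neg]
    refine EReal.add_le_of_forall_lt fun a ha b hb => ?_
    obtain ⟨x, hx⟩ := lt_iSup_iff.1 ha
    obtain ⟨z, hz⟩ := lt_iSup_iff.1 hb
    refine (add_le_add hx.le hz.le).trans ((hterm x z).trans_le ?_)
    exact EReal.neg_le_neg_iff.2 (iInf₂_le (f := fun x z => splitObj f g x z - _) x z)
  · refine le_iInf₂ fun x z => ?_
    rw [EReal.neg_le, ← hterm]
    exact add_le_add (le_iSup (fun x => ((⟪_, x⟫_ℝ : ℝ) : EReal) - f x) x)
      (le_iSup (fun z => ((⟪_, z⟫_ℝ : ℝ) : EReal) - g z) z)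

theorem splitObj_sub_dualFun_of_mem_subdiff (hf : IsProperFun f) (hg : IsProperFun g) {x : E}
    {p z : V} (hx : ContinuousLinearMap.adjoint A p ∈ subdiff f x) (hz : -p ∈ subdiff g z) :
    splitObj f g x z - dualFun f g A p = ((⟪p, A x - z⟫_ℝ : ℝ) : EReal) := by
  have hF : f x + dualF f A p = ((⟪p, A x⟫_ℝ : ℝ) : EReal) := by
    rw [← ContinuousLinearMap.adjoint_inner_left]
    exact hf.add_convexConj_eq_inner hx
  have hG : g z + dualG g p = ((-⟪p, z⟫_ℝ : ℝ) : EReal) := by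
    rw [← inner_neg_left]
    exact hg.add_convexConj_eq_inner hz
  rw [dualFun_eq_neg_dualObj hf hg, sub_eq_add_neg, neg_neg, splitObj, dualObj,
    add_add_add_comm, hF, hG, ← EReal.coe_add, inner_sub_right, sub_eq_add_neg]

theorem primalObj_sub_dualFun_le_of_mem_subdiff (hf : IsProperFun f) (hg : IsProperFun g) {x : E}
    {d p z : V} (hx : ContinuousLinearMap.adjoint A p ∈ subdiff f x) (hz : -p ∈ subdiff g z)
    (hd : d ∈ subdiff g (A x)) :
    primalObj f g A x - dualFun f g A p ≤ ((⟪p + d, A x - z⟫_ℝ : ℝ) : EReal) := by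
  have hgx : g (A x) ≤ g z + ((⟪d, A x - z⟫_ℝ : ℝ) : EReal) := by
    have hle := hd z
    rw [← neg_sub (A x) z, inner_neg_right, EReal.coe_neg, ← sub_eq_add_neg] at hle
    exact (EReal.sub_le_iff_le_add (Or.inl (EReal.coe_ne_bot _))
      (Or.inl (EReal.coe_ne_top _))).1 hle
  calc primalObj f g A x - dualFun f g A p
      ≤ (f x + (g z + ((⟪d, A x - z⟫_ℝ : ℝ) : EReal))) - dualFun f g A p :=
        EReal.sub_le_sub (add_le_add_right hgx _) le_rfl
    _ = (splitObj f g x z - dualFun f g A p) + ((⟪d, A x - z⟫_ℝ : ℝ) : EReal) := by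
        simp only [splitObj, sub_eq_add_neg]
        ac_rfl
    _ = ((⟪p + d, A x - z⟫_ℝ : ℝ) : EReal) := by
        rw [splitObj_sub_dualFun_of_mem_subdiff hf hg hx hz, ← EReal.coe_add, inner_add_left]

theorem splitObj_sub_dualFun_le (hf : IsProperFun f) (hg : IsProperFun g) {x : E}
    {p z : V} (hx : ContinuousLinearMap.adjoint A p ∈ subdiff f x) (hz : -p ∈ subdiff g z) :
    splitObj f g x z - dualFun f g A p ≤ ((‖p‖ * ‖A x - z‖ : ℝ) : EReal) := by
  rw [splitObj_sub_dualFun_of_mem_subdiff hf hg hx hz]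
  exact EReal.coe_le_coe_iff.2 (real_inner_le_norm _ _)

theorem primalObj_sub_dualFun_le (hf : IsProperFun f) (hg : IsProperFun g)
    (hbdd : HasBoundedSubgradients g) {x : E} {p z : V}
    (hx : ContinuousLinearMap.adjoint A p ∈ subdiff f x) (hz : -p ∈ subdiff g z) :
    primalObj f g A x - dualFun f g A p ≤
      (((‖p‖ + subgradBound g) * ‖A x - z‖ : ℝ) : EReal) := by
  obtain ⟨d, hd⟩ := hbdd.1 (A x)
  have hdnorm : ‖d‖ ≤ subgradBound g := le_csSup hbdd.2 ⟨A x, d, hd, rfl⟩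
  refine (primalObj_sub_dualFun_le_of_mem_subdiff hf hg hx hz hd).trans
    (EReal.coe_le_coe_iff.2 ?_)
  calc ⟪p + d, A x - z⟫_ℝ ≤ ‖p + d‖ * ‖A x - z‖ := real_inner_le_norm _ _
    _ ≤ (‖p‖ + subgradBound g) * ‖A x - z‖ := by
      gcongr
      exact (norm_add_le p d).trans (by gcongr)

end DualProblem

/-- `p` is reached from `w` by a step of size `1 / L` satisfying the three-point inequality of the
proximal gradient method for the objective `Φ`; the convergence analysis of accelerated methods
uses nothing else about the step. -/
def IsDescentStep {V : Type*} [NormedAddCommGroup V] (Φ : V → EReal) (L : ℝ) (w p : V) : Prop :=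
  ∀ y, Φ p + ((L / 2 * ‖y - p‖ ^ 2 : ℝ) : EReal) ≤ Φ y + ((L / 2 * ‖y - w‖ ^ 2 : ℝ) : EReal)

section ProximalStep

variable {E V : Type*} [NormedAddCommGroup E] [InnerProductSpace ℝ E] [CompleteSpace E]
  [NormedAddCommGroup V] [InnerProductSpace ℝ V] [CompleteSpace V]
  {f : E → EReal} {g : V → EReal} {A : E →L[ℝ] V} {σ L : ℝ} {p w : V}

theorem quadModel_add_norm_sq_le (hp : -p ∈ subdiff g (gradF f A w + L • (p - w))) (y : V) :
    quadModel f g A L p w + ((L / 2 * ‖y - p‖ ^ 2 : ℝ) : EReal) ≤ quadModel f g A L y w := by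
  set z := gradF f A w + L • (p - w) with hz
  have hreal : ⟪p - w, gradF f A w⟫_ℝ + L / 2 * ‖p - w‖ ^ 2 + L / 2 * ‖y - p‖ ^ 2 =
      ⟪y - w, gradF f A w⟫_ℝ + L / 2 * ‖y - w‖ ^ 2 + ⟪-z, y - p⟫_ℝ := by
    rw [← sub_add_sub_cancel y p w, norm_add_sq_real, inner_add_left, hz, inner_neg_left,
      inner_add_left, inner_smul_left, real_inner_comm (y - p), real_inner_comm (y - p) (p - w)]
    simp only [conj_trivial]
    ring
  calc quadModel f g A L p w + ((L / 2 * ‖y - p‖ ^ 2 : ℝ) : EReal)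
      = dualF f A w + ((⟪p - w, gradF f A w⟫_ℝ + L / 2 * ‖p - w‖ ^ 2 + L / 2 * ‖y - p‖ ^ 2 : ℝ) :
          EReal) + dualG g p := by rw [quadModel, EReal.coe_add _ (L / 2 * ‖y - p‖ ^ 2)]; ac_rfl
    _ = dualF f A w + ((⟪y - w, gradF f A w⟫_ℝ + L / 2 * ‖y - w‖ ^ 2 : ℝ) : EReal)
          + (dualG g p + ((⟪-z, y - p⟫_ℝ : ℝ) : EReal)) := by rw [hreal, EReal.coe_add]; ac_rfl
    _ ≤ quadModel f g A L y w := by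
      rw [quadModel]
      gcongr
      exact neg_mem_subdiff_dualG hp y

omit [CompleteSpace V] in
theorem exists_dualG_eq_coe (hg : IsProperFun g) {z : V} (hz : -p ∈ subdiff g z) :
    ∃ c : ℝ, dualG g p = c := by
  obtain ⟨s, hs⟩ := hg.exists_eq_coe_of_mem_subdiff hz
  exact ⟨⟪-p, z⟫_ℝ - s, by rw [dualG, convexConj_eq_of_mem_subdiff hz, hs, EReal.coe_sub]⟩

theorem proxGrad_eq_of_neg_mem_subdiff (hf : IsClosedProperStronglyConvex σ f) (hσ : 0 < σ)
    (hg : IsProperFun g) (hL : 0 < L) (hp : -p ∈ subdiff g (gradF f A w + L • (p - w))) :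
    proxGrad f g A L w = p := by
  obtain ⟨c, hc⟩ : ∃ c : ℝ, quadModel f g A L p w = c := by
    obtain ⟨s, hs⟩ := exists_dualG_eq_coe hg hp
    exact ⟨_, by rw [quadModel, ← coe_toReal_dualF hf hσ, hs, ← EReal.coe_add, ← EReal.coe_add]⟩
  have hmin : IsMinOn (fun y => quadModel f g A L y w) Set.univ p := by
    refine isMinOn_univ_iff.2 fun y => le_trans ?_ (quadModel_add_norm_sq_le hp y)
    exact le_add_of_nonneg_right (EReal.coe_nonneg.2 (by positivity))
  have hprox : IsMinOn (fun y => quadModel f g A L y w) Set.univ (proxGrad f g A L w) :=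
    Classical.epsilon_spec ⟨p, hmin⟩
  have hle := (quadModel_add_norm_sq_le hp (proxGrad f g A L w)).trans
    (isMinOn_univ_iff.1 hprox p)
  rw [hc, ← EReal.coe_add, EReal.coe_le_coe_iff] at hle
  have hsq : ‖proxGrad f g A L w - p‖ ^ 2 ≤ 0 := by
    refine nonpos_of_mul_nonpos_right ?_ (half_pos hL)
    linarith
  rw [← sub_eq_zero, ← norm_eq_zero, ← sq_eq_zero_iff]
  exact hsq.antisymm (sq_nonneg _)

theorem neg_proxGrad_mem_subdiff_proxZ (hf : IsClosedProperStronglyConvex σ f) (hσ : 0 < σ)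
    (hg : IsClosedProperStronglyConvex 0 g) (A : E →L[ℝ] V) (hL : 0 < L) (w : V) :
    -proxGrad f g A L w ∈ subdiff g (proxZ f g A L w) := by
  set b := gradF f A w - L • w with hb
  obtain ⟨z, hz⟩ := hg.exists_sub_smul_mem_subdiff (inv_pos.2 hL) (L⁻¹ • b)
  set p := L⁻¹ • (z - b) with hp
  have hpz : gradF f A w + L • (p - w) = z := by
    rw [hp, smul_sub, smul_inv_smul₀ hL.ne', hb]
    abel
  have hmem : -p ∈ subdiff g z := by
    rwa [hp, ← smul_neg, neg_sub, smul_sub]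
  rw [← hpz] at hmem
  rwa [proxZ, ← gradF_eq hf hσ, proxGrad_eq_of_neg_mem_subdiff hf hσ hg.proper hL hmem]

theorem quadModel_le_dualObj_add_norm_sq (hf : IsClosedProperStronglyConvex σ f) (hσ : 0 < σ)
    (g : V → EReal) (A : E →L[ℝ] V) (L : ℝ) (y w : V) :
    quadModel f g A L y w ≤ dualObj f g A y + ((L / 2 * ‖y - w‖ ^ 2 : ℝ) : EReal) := by
  have hF := map_mem_subdiff_dualF (adjoint_mem_subdiff_primalX hf hσ A w) y
  rw [← gradF_eq hf hσ, real_inner_comm] at hF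
  calc quadModel f g A L y w
      = dualF f A w + ((⟪y - w, gradF f A w⟫_ℝ : ℝ) : EReal)
          + ((L / 2 * ‖y - w‖ ^ 2 : ℝ) : EReal) + dualG g y := by
        simp only [quadModel, EReal.coe_add, add_assoc]
    _ ≤ dualF f A y + ((L / 2 * ‖y - w‖ ^ 2 : ℝ) : EReal) + dualG g y := by gcongr
    _ = dualObj f g A y + ((L / 2 * ‖y - w‖ ^ 2 : ℝ) : EReal) := by rw [dualObj, add_right_comm]

theorem BacktrackCond.isDescentStep (hback : BacktrackCond f g A L w)
    (hf : IsClosedProperStronglyConvex σ f) (hσ : 0 < σ) (hg : IsClosedProperStronglyConvex 0 g)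
    (hL : 0 < L) : IsDescentStep (dualObj f g A) L w (proxGrad f g A L w) := by
  have hprox := neg_proxGrad_mem_subdiff_proxZ hf hσ hg A hL w
  rw [proxZ, ← gradF_eq hf hσ] at hprox
  intro y
  calc dualObj f g A (proxGrad f g A L w) + ((L / 2 * ‖y - proxGrad f g A L w‖ ^ 2 : ℝ) : EReal)
      ≤ quadModel f g A L (proxGrad f g A L w) w
          + ((L / 2 * ‖y - proxGrad f g A L w‖ ^ 2 : ℝ) : EReal) := add_le_add_left hback _
    _ ≤ quadModel f g A L y w := quadModel_add_norm_sq_le hprox y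
    _ ≤ dualObj f g A y + ((L / 2 * ‖y - w‖ ^ 2 : ℝ) : EReal) :=
      quadModel_le_dualObj_add_norm_sq hf hσ g A L y w

theorem norm_map_primalX_proxGrad_sub_proxZ_le (hf : IsClosedProperStronglyConvex σ f)
    (hσ : 0 < σ) (g : V → EReal) (A : E →L[ℝ] V) (hL : 0 ≤ L) (w : V) :
    ‖A (primalX f A (proxGrad f g A L w)) - proxZ f g A L w‖ ≤
      (L + ‖A‖ ^ 2 / σ) * ‖proxGrad f g A L w - w‖ := by
  rw [proxZ, ← sub_sub]
  refine (norm_sub_le _ _).trans ?_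
  rw [norm_smul, Real.norm_of_nonneg hL, add_mul, add_comm]
  gcongr
  exact norm_map_primalX_sub_le hf hσ A _ _

theorem isProperFun_dualObj (hf : IsClosedProperStronglyConvex σ f) (hσ : 0 < σ)
    (hg : IsClosedProperStronglyConvex 0 g) (A : E →L[ℝ] V) : IsProperFun (dualObj f g A) := by
  obtain ⟨s, hs⟩ := exists_dualG_eq_coe hg.proper
    (neg_proxGrad_mem_subdiff_proxZ hf hσ hg A one_pos 0)
  refine ⟨fun y => EReal.add_ne_bot_iff.2
    ⟨hf.proper.convexConj_ne_bot _, hg.proper.convexConj_ne_bot _⟩, proxGrad f g A 1 0, ?_⟩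
  rw [dualObj, ← coe_toReal_dualF hf hσ, hs, ← EReal.coe_add]
  exact EReal.coe_ne_top _

theorem isMinOn_dualObj (hf : IsProperFun f) (hg : IsProperFun g) {y : V}
    (hy : IsMaxOn (dualFun f g A) Set.univ y) : IsMinOn (dualObj f g A) Set.univ y :=
  isMinOn_univ_iff.2 fun v => by
    simpa only [dualFun_eq_neg_dualObj hf hg, EReal.neg_le_neg_iff] using isMaxOn_univ_iff.1 hy v

end ProximalStep

theorem IsProperFun.ne_top_of_isMinOn {X : Type*} {Φ : X → EReal} {x : X} (hΦ : IsProperFun Φ)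
    (hx : IsMinOn Φ Set.univ x) : Φ x ≠ ⊤ := by
  obtain ⟨-, u, hu⟩ := hΦ
  exact ne_top_of_le_ne_top hu (isMinOn_univ_iff.1 hx u)

theorem IsProperFun.toReal_le_of_isMinOn {X : Type*} {Φ : X → EReal} {u x : X}
    (hΦ : IsProperFun Φ) (hx : IsMinOn Φ Set.univ x) (hu : Φ u ≠ ⊤) :
    (Φ x).toReal ≤ (Φ u).toReal :=
  EReal.toReal_le_toReal (isMinOn_univ_iff.1 hx u) (hΦ.1 x) hu

section DescentStep

variable {V : Type*} [NormedAddCommGroup V] {Φ : V → EReal} {L : ℝ} {w p u ys : V}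

theorem IsDescentStep.ne_top (h : IsDescentStep Φ L w p) (hΦ : IsProperFun Φ) : Φ p ≠ ⊤ := by
  obtain ⟨-, u, hu⟩ := hΦ
  intro hp
  have hle := h u
  rw [hp, EReal.top_add_coe, top_le_iff] at hle
  exact EReal.add_ne_top hu (EReal.coe_ne_top _) hle

theorem IsDescentStep.mul_norm_sq_sub_le (h : IsDescentStep Φ L w p) (hΦ : IsProperFun Φ)
    (hu : Φ u ≠ ⊤) :
    L / 2 * (‖u - p‖ ^ 2 - ‖u - w‖ ^ 2) ≤ (Φ u).toReal - (Φ p).toReal := by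
  have hle := h u
  rw [← EReal.coe_toReal hu (hΦ.1 u), ← EReal.coe_toReal (h.ne_top hΦ) (hΦ.1 p),
    ← EReal.coe_add, ← EReal.coe_add, EReal.coe_le_coe_iff] at hle
  linarith

theorem IsDescentStep.norm_sub_le (h : IsDescentStep Φ L w p) (hΦ : IsProperFun Φ)
    (hys : IsMinOn Φ Set.univ ys) (hL : 0 < L) : ‖p - ys‖ ≤ ‖w - ys‖ := by
  have hle := (h.mul_norm_sq_sub_le hΦ (hΦ.ne_top_of_isMinOn hys)).trans
    (sub_nonpos.2 (hΦ.toReal_le_of_isMinOn hys (h.ne_top hΦ)))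
  rw [norm_sub_rev p, norm_sub_rev w, ← sq_le_sq₀ (norm_nonneg _) (norm_nonneg _)]
  exact sub_nonpos.1 (nonpos_of_mul_nonpos_right hle (half_pos hL))

end DescentStep

section Acceleration

variable {V : Type*} [NormedAddCommGroup V] [InnerProductSpace ℝ V]

theorem mul_norm_sq_sub_add_mul_norm_sq_sub_eq {S t : ℝ} {y y' w u : V}
    (hw : (S + t) • w = S • y + t • u) (x : V) :
    t * (‖x - y'‖ ^ 2 - ‖x - w‖ ^ 2) + S * (‖y - y'‖ ^ 2 - ‖y - w‖ ^ 2) =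
      (S + t - t ^ 2) * ‖y' - w‖ ^ 2 + ‖u + t • (y' - w) - x‖ ^ 2 - ‖u - x‖ ^ 2 := by
  set d := y' - w with hd
  have hexpand (v : V) : ‖v - y'‖ ^ 2 - ‖v - w‖ ^ 2 = ‖d‖ ^ 2 + 2 * (⟪d, w⟫_ℝ - ⟪d, v⟫_ℝ) := by
    rw [← sub_sub_sub_cancel_right v y' w, ← hd, norm_sub_sq_real, real_inner_comm,
      inner_sub_right]
    ring
  have haux : ‖u + t • d - x‖ ^ 2 - ‖u - x‖ ^ 2 =
      2 * t * (⟪d, u⟫_ℝ - ⟪d, x⟫_ℝ) + t ^ 2 * ‖d‖ ^ 2 := by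
    rw [add_sub_right_comm, norm_add_sq_real, inner_smul_right, real_inner_comm, inner_sub_right,
      norm_smul, mul_pow, Real.norm_eq_abs, sq_abs]
    ring
  have hinner : (S + t) * ⟪d, w⟫_ℝ = S * ⟪d, y⟫_ℝ + t * ⟪d, u⟫_ℝ := by
    simpa only [inner_add_right, inner_smul_right] using congrArg (fun v => ⟪d, v⟫_ℝ) hw
  rw [hexpand, hexpand, add_sub_assoc, haux]
  linear_combination 2 * hinner

theorem accelerated_step_le {L S t v v' vs : ℝ} {y y' w u ys : V} (hL : 0 < L) (ht : 0 ≤ t)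
    (hw : (S + t) • w = S • y + t • u)
    (hys : L / 2 * (‖ys - y'‖ ^ 2 - ‖ys - w‖ ^ 2) ≤ vs - v')
    (hy : S * (L / 2 * (‖y - y'‖ ^ 2 - ‖y - w‖ ^ 2)) ≤ S * (v - v')) :
    (S + t - t ^ 2) * ‖y' - w‖ ^ 2 + ‖u + t • (y' - w) - ys‖ ^ 2 + 2 * ((S + t) * (v' - vs)) / L ≤
      ‖u - ys‖ ^ 2 + 2 * (S * (v - vs)) / L := by
  have hcomb : L / 2 * (t * (‖ys - y'‖ ^ 2 - ‖ys - w‖ ^ 2) + S * (‖y - y'‖ ^ 2 - ‖y - w‖ ^ 2)) ≤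
      S * (v - vs) - (S + t) * (v' - vs) := by
    linear_combination mul_le_mul_of_nonneg_left hys ht + hy
  have hdiv : t * (‖ys - y'‖ ^ 2 - ‖ys - w‖ ^ 2) + S * (‖y - y'‖ ^ 2 - ‖y - w‖ ^ 2) ≤
      2 * (S * (v - vs)) / L - 2 * ((S + t) * (v' - vs)) / L := by
    rw [← sub_div, le_div_iff₀ hL]
    linarith
  rw [mul_norm_sq_sub_add_mul_norm_sq_sub_eq hw] at hdiv
  linarith

/-- The auxiliary sequence `u_k = y_0 + ∑_{i < k} t_i (y_{i+1} - w_i)` of an accelerated method,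
whose distance to a minimizer enters the potential function. -/
def auxSeq (t : ℕ → ℝ) (y w : ℕ → V) (k : ℕ) : V :=
  y 0 + ∑ i ∈ Finset.range k, t i • (y (i + 1) - w i)

theorem auxSeq_succ (t : ℕ → ℝ) (y w : ℕ → V) (k : ℕ) :
    auxSeq t y w (k + 1) = auxSeq t y w k + t k • (y (k + 1) - w k) := by
  rw [auxSeq, Finset.sum_range_succ, ← add_assoc, auxSeq]

theorem partialT_eq_sum_range_add (t : ℕ → ℝ) (k : ℕ) :
    partialT t k = ∑ i ∈ Finset.range k, t i + t k :=
  Finset.sum_range_succ t k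

theorem partialT_pos {t : ℕ → ℝ} (ht : ∀ i, 0 < t i) (k : ℕ) : 0 < partialT t k :=
  Finset.sum_pos (fun i _ => ht i) Finset.nonempty_range_add_one

/-- An accelerated descent method for `Φ`, with weights `t_k` and step sizes `1 / L_{k+1}`: the
step to `y_{k+1}` starts from the average `w_k` of `y_k` and `u_k = auxSeq t y w k` with weights
`t_0 + ⋯ + t_{k-1}` and `t_k`. -/
structure IsAcceleratedScheme (Φ : V → EReal) (t L : ℕ → ℝ) (y w : ℕ → V) : Prop where
  t_pos : ∀ k, 0 < t k
  t_sq_le : ∀ k, t k ^ 2 ≤ partialT t k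
  L_pos : ∀ k, 0 < L k
  L_mono : Monotone L
  smul_w : ∀ k, partialT t k • w k = (∑ i ∈ Finset.range k, t i) • y k + t k • auxSeq t y w k
  descent : ∀ k, IsDescentStep Φ (L (k + 1)) (w k) (y (k + 1))

namespace IsAcceleratedScheme

variable {Φ : V → EReal} {t L : ℕ → ℝ} {y w : ℕ → V} {ys : V}

theorem sum_t_nonneg (h : IsAcceleratedScheme Φ t L y w) (k : ℕ) :
    0 ≤ ∑ i ∈ Finset.range k, t i :=
  Finset.sum_nonneg fun i _ => (h.t_pos i).le

/-- The starting point may have `Φ (y 0) = ⊤`, but its weight is the empty sum. -/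
theorem sum_t_eq_zero_or_ne_top (h : IsAcceleratedScheme Φ t L y w) (hΦ : IsProperFun Φ) (k : ℕ) :
    ∑ i ∈ Finset.range k, t i = 0 ∨ Φ (y k) ≠ ⊤ := by
  cases k with
  | zero => exact Or.inl (Finset.sum_range_zero t)
  | succ k => exact Or.inr ((h.descent k).ne_top hΦ)

theorem sum_t_mul_le_of_isDescentStep (h : IsAcceleratedScheme Φ t L y w) (hΦ : IsProperFun Φ)
    {k : ℕ} {M : ℝ} {v p : V} (hp : IsDescentStep Φ M v p) :
    (∑ i ∈ Finset.range k, t i) * (M / 2 * (‖y k - p‖ ^ 2 - ‖y k - v‖ ^ 2)) ≤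
      (∑ i ∈ Finset.range k, t i) * ((Φ (y k)).toReal - (Φ p).toReal) := by
  rcases h.sum_t_eq_zero_or_ne_top hΦ k with hzero | hy
  · rw [hzero, zero_mul, zero_mul]
  · exact mul_le_mul_of_nonneg_left (hp.mul_norm_sq_sub_le hΦ hy) (h.sum_t_nonneg k)

theorem sum_t_mul_toReal_sub_nonneg (h : IsAcceleratedScheme Φ t L y w) (hΦ : IsProperFun Φ)
    (hys : IsMinOn Φ Set.univ ys) (k : ℕ) :
    0 ≤ (∑ i ∈ Finset.range k, t i) * ((Φ (y k)).toReal - (Φ ys).toReal) := by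
  rcases h.sum_t_eq_zero_or_ne_top hΦ k with hzero | hy
  · rw [hzero, zero_mul]
  · exact mul_nonneg (h.sum_t_nonneg k) (sub_nonneg.2 (hΦ.toReal_le_of_isMinOn hys hy))

theorem potential_le (h : IsAcceleratedScheme Φ t L y w) (hΦ : IsProperFun Φ)
    (hys : IsMinOn Φ Set.univ ys) (k : ℕ) :
    ∑ i ∈ Finset.range k, (partialT t i - t i ^ 2) * ‖y (i + 1) - w i‖ ^ 2
      + ‖auxSeq t y w k - ys‖ ^ 2
      + 2 * ((∑ i ∈ Finset.range k, t i) * ((Φ (y k)).toReal - (Φ ys).toReal)) / L k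
      ≤ ‖y 0 - ys‖ ^ 2 := by
  induction k with
  | zero => simp [auxSeq]
  | succ k ih =>
    have hw := h.smul_w k
    rw [partialT_eq_sum_range_add] at hw
    have hstep := accelerated_step_le (h.L_pos (k + 1)) (h.t_pos k).le hw
      ((h.descent k).mul_norm_sq_sub_le hΦ (hΦ.ne_top_of_isMinOn hys))
      (h.sum_t_mul_le_of_isDescentStep hΦ (h.descent k))
    rw [← partialT_eq_sum_range_add, ← auxSeq_succ] at hstep
    have hL : 2 * ((∑ i ∈ Finset.range k, t i) * ((Φ (y k)).toReal - (Φ ys).toReal)) / L (k + 1) ≤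
        2 * ((∑ i ∈ Finset.range k, t i) * ((Φ (y k)).toReal - (Φ ys).toReal)) / L k :=
      div_le_div_of_nonneg_left
        (mul_nonneg zero_le_two (h.sum_t_mul_toReal_sub_nonneg hΦ hys k)) (h.L_pos k)
        (h.L_mono k.le_succ)
    rw [Finset.sum_range_succ, ← partialT]
    linarith

theorem norm_auxSeq_sub_le (h : IsAcceleratedScheme Φ t L y w) (hΦ : IsProperFun Φ)
    (hys : IsMinOn Φ Set.univ ys) (k : ℕ) : ‖auxSeq t y w k - ys‖ ≤ ‖y 0 - ys‖ := by
  have hpot := h.potential_le hΦ hys k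
  have hsteps : 0 ≤ ∑ i ∈ Finset.range k, (partialT t i - t i ^ 2) * ‖y (i + 1) - w i‖ ^ 2 :=
    Finset.sum_nonneg fun i _ => mul_nonneg (sub_nonneg.2 (h.t_sq_le i)) (sq_nonneg _)
  have hgap := div_nonneg (mul_nonneg zero_le_two (h.sum_t_mul_toReal_sub_nonneg hΦ hys k))
    (h.L_pos k).le
  rw [← sq_le_sq₀ (norm_nonneg _) (norm_nonneg _)]
  linarith

theorem norm_iterate_sub_le (h : IsAcceleratedScheme Φ t L y w) (hΦ : IsProperFun Φ)
    (hys : IsMinOn Φ Set.univ ys) (k : ℕ) : ‖y k - ys‖ ≤ ‖y 0 - ys‖ := by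
  induction k with
  | zero => exact le_rfl
  | succ k ih =>
    refine ((h.descent k).norm_sub_le hΦ hys (h.L_pos (k + 1))).trans
      (le_of_mul_le_mul_left ?_ (partialT_pos h.t_pos k))
    have hw : partialT t k • (w k - ys) =
        (∑ i ∈ Finset.range k, t i) • (y k - ys) + t k • (auxSeq t y w k - ys) := by
      rw [smul_sub, h.smul_w, partialT_eq_sum_range_add]
      module
    calc partialT t k * ‖w k - ys‖ = ‖partialT t k • (w k - ys)‖ := by
          rw [norm_smul, Real.norm_of_nonneg (partialT_pos h.t_pos k).le]
      _ ≤ (∑ i ∈ Finset.range k, t i) * ‖y k - ys‖ + t k * ‖auxSeq t y w k - ys‖ := by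
          rw [hw]
          refine (norm_add_le _ _).trans_eq ?_
          rw [norm_smul, norm_smul, Real.norm_of_nonneg (h.sum_t_nonneg k),
            Real.norm_of_nonneg (h.t_pos k).le]
      _ ≤ (∑ i ∈ Finset.range k, t i) * ‖y 0 - ys‖ + t k * ‖y 0 - ys‖ := add_le_add
          (mul_le_mul_of_nonneg_left ih (h.sum_t_nonneg k))
          (mul_le_mul_of_nonneg_left (h.norm_auxSeq_sub_le hΦ hys k) (h.t_pos k).le)
      _ = partialT t k * ‖y 0 - ys‖ := by rw [← add_mul, partialT_eq_sum_range_add]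

theorem sum_mul_norm_sq_le (h : IsAcceleratedScheme Φ t L y w) (hΦ : IsProperFun Φ)
    (hys : IsMinOn Φ Set.univ ys) {k : ℕ} {L' : ℝ} {p : V} (hL' : L k ≤ L')
    (hp : IsDescentStep Φ L' (y k) p) :
    ∑ i ∈ Finset.range k, (partialT t i - t i ^ 2) * ‖y (i + 1) - w i‖ ^ 2
      + (∑ i ∈ Finset.range k, t i) * ‖p - y k‖ ^ 2 ≤ ‖y 0 - ys‖ ^ 2 := by
  have hpot := h.potential_le hΦ hys k
  have hdescent := h.sum_t_mul_le_of_isDescentStep hΦ (k := k) hp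
  rw [sub_self, norm_zero, norm_sub_rev] at hdescent
  have hgap := mul_le_mul_of_nonneg_left (hΦ.toReal_le_of_isMinOn hys (hp.ne_top hΦ))
    (h.sum_t_nonneg k)
  have hlast : (∑ i ∈ Finset.range k, t i) * ‖p - y k‖ ^ 2 ≤
      2 * ((∑ i ∈ Finset.range k, t i) * ((Φ (y k)).toReal - (Φ ys).toReal)) / L k := by
    rw [le_div_iff₀ (h.L_pos k)]
    have := mul_le_mul_of_nonneg_left hL' (mul_nonneg (h.sum_t_nonneg k) (sq_nonneg ‖p - y k‖))
    linarith
  linarith [sq_nonneg ‖auxSeq t y w k - ys‖]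

end IsAcceleratedScheme

end Acceleration

section StepLength

theorem exists_le_or_le_of_sum_mul_sq_le {ι : Type*} {s : Finset ι} {c d : ι → ℝ} {b e R : ℝ}
    (hc : ∀ i ∈ s, 0 ≤ c i) (hb : 0 < b) (hR : 0 ≤ R)
    (h : ∑ i ∈ s, c i * d i ^ 2 + b * e ^ 2 ≤ R ^ 2) :
    (∃ i ∈ s, d i ≤ R / √(∑ i ∈ s, c i + b)) ∨ e ≤ R / √(∑ i ∈ s, c i + b) := by
  have hW : 0 < ∑ i ∈ s, c i + b := add_pos_of_nonneg_of_pos (Finset.sum_nonneg hc) hb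
  set δ := R / √(∑ i ∈ s, c i + b) with hδ
  have hδ0 : 0 ≤ δ := by positivity
  by_contra! hlong
  obtain ⟨hd, he⟩ := hlong
  have hsum : (∑ i ∈ s, c i) * δ ^ 2 ≤ ∑ i ∈ s, c i * d i ^ 2 := by
    rw [Finset.sum_mul]
    refine Finset.sum_le_sum fun i hi => mul_le_mul_of_nonneg_left ?_ (hc i hi)
    exact pow_le_pow_left₀ hδ0 (hd i hi).le 2
  have hlast : b * δ ^ 2 < b * e ^ 2 := by gcongr
  have htotal : (∑ i ∈ s, c i + b) * δ ^ 2 = R ^ 2 := by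
    rw [hδ, div_pow, Real.sq_sqrt hW.le, mul_div_cancel₀ _ hW.ne']
  linarith

/-- The total weight of the squared step lengths in the estimate
`IsAcceleratedScheme.sum_mul_norm_sq_le`, which determines the rate of convergence. -/
def stepWeight (t : ℕ → ℝ) (k : ℕ) : ℝ :=
  ∑ i ∈ Finset.range k, (partialT t i - t i ^ 2) + ∑ i ∈ Finset.range k, t i

theorem IsAcceleratedScheme.exists_norm_sub_le {V : Type*} [NormedAddCommGroup V]
    [InnerProductSpace ℝ V] {Φ : V → EReal} {t L : ℕ → ℝ} {y w : ℕ → V} {ys : V}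
    (h : IsAcceleratedScheme Φ t L y w) (hΦ : IsProperFun Φ) (hys : IsMinOn Φ Set.univ ys) {k : ℕ}
    (hk : 1 ≤ k) {L' : ℝ} {p : V} (hL' : L k ≤ L') (hp : IsDescentStep Φ L' (y k) p) :
    (∃ i ∈ Finset.range k, ‖y (i + 1) - w i‖ ≤ ‖y 0 - ys‖ / √(stepWeight t k)) ∨
      ‖p - y k‖ ≤ ‖y 0 - ys‖ / √(stepWeight t k) :=
  exists_le_or_le_of_sum_mul_sq_le (fun i _ => sub_nonneg.2 (h.t_sq_le i))
    (Finset.sum_pos (fun i _ => h.t_pos i) (Finset.nonempty_range_iff.2 (by lia))) (norm_nonneg _)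
    (h.sum_mul_norm_sq_le hΦ hys hL' hp)

theorem partialT_linear {a : ℝ} (ha : a ≠ 0) (k : ℕ) :
    partialT (fun i => ((i : ℝ) + a) / a) k = (k + 1) * (k + 2 * a) / (2 * a) := by
  induction k with
  | zero =>
    rw [partialT, Finset.sum_range_one]
    field_simp
    push_cast
    ring
  | succ k ih =>
    rw [partialT, Finset.sum_range_succ, ← partialT, ih]
    field_simp
    push_cast
    ring

theorem le_stepWeight_linear {a : ℝ} (ha : a ≠ 0) (k : ℕ) :
    (a - 2) * (k : ℝ) ^ 3 / (6 * a ^ 2) ≤ stepWeight (fun i => ((i : ℝ) + a) / a) k := by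
  rw [stepWeight, ← Finset.sum_add_distrib]
  induction k with
  | zero => simp
  | succ k ih =>
    rw [Finset.sum_range_succ, partialT_linear ha]
    have hincrement :
        (a - 2) * ((k + 1 : ℕ) : ℝ) ^ 3 / (6 * a ^ 2) - (a - 2) * (k : ℝ) ^ 3 / (6 * a ^ 2) ≤
          (k + 1) * (k + 2 * a) / (2 * a) - (((k : ℝ) + a) / a) ^ 2 + (k + a) / a := by
      have hnum : 0 ≤ 6 * k * (a ^ 2 - a + 1) + (6 * a ^ 2 - a + 2) :=
        add_nonneg (mul_nonneg (by positivity) (by nlinarith)) (by nlinarith)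
      rw [← sub_nonneg]
      refine (div_nonneg hnum (by positivity : 0 ≤ 6 * a ^ 2)).trans_eq ?_
      push_cast
      field_simp
      ring
    linarith

theorem div_sqrt_stepWeight_linear_le {a R : ℝ} (ha : 2 < a) (hR : 0 ≤ R) {k : ℕ} (hk : 1 ≤ k) :
    R / √(stepWeight (fun i => ((i : ℝ) + a) / a) k) ≤
      a * √6 / √(a - 2) * (R / (k : ℝ) ^ (1.5 : ℝ)) := by
  have ha0 : 0 < a := by linarith
  have ha2 : 0 < a - 2 := by linarith
  have hk0 : (0 : ℝ) < k := by exact_mod_cast hk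
  have hpow : √((k : ℝ) ^ 3) = (k : ℝ) ^ (1.5 : ℝ) := by
    rw [Real.sqrt_eq_rpow, ← Real.rpow_natCast, ← Real.rpow_mul hk0.le]
    norm_num
  calc R / √(stepWeight (fun i => ((i : ℝ) + a) / a) k)
      ≤ R / √((a - 2) * (k : ℝ) ^ 3 / (6 * a ^ 2)) := by
        gcongr
        exact le_stepWeight_linear ha0.ne' k
    _ = a * √6 / √(a - 2) * (R / (k : ℝ) ^ (1.5 : ℝ)) := by
        rw [Real.sqrt_div' _ (by positivity), Real.sqrt_mul ha2.le, Real.sqrt_mul (by norm_num),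
          Real.sqrt_sq ha0.le, hpow]
        field_simp

end StepLength

section DualConvergence

variable {E V : Type*} [NormedAddCommGroup E] [InnerProductSpace ℝ E] [CompleteSpace E]
  [NormedAddCommGroup V] [InnerProductSpace ℝ V] [CompleteSpace V]
  {f : E → EReal} {g : V → EReal} {A : E →L[ℝ] V} {σ : ℝ} {t L : ℕ → ℝ} {y w : ℕ → V} {ys : V}

theorem norm_proxGrad_add_mul_le (hf : IsClosedProperStronglyConvex σ f) (hσ : 0 < σ)
    (g : V → EReal) (A : E →L[ℝ] V) {v : V} {γ δ M L' R : ℝ} (hγ : 0 ≤ γ) (hM : 0 ≤ M)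
    (hML : M ≤ L') (hR : ‖proxGrad f g A M v - ys‖ ≤ R) (hδ : ‖proxGrad f g A M v - v‖ ≤ δ) :
    (‖proxGrad f g A M v‖ + γ) * ‖A (primalX f A (proxGrad f g A M v)) - proxZ f g A M v‖ ≤
      (L' + ‖A‖ ^ 2 / σ) * (R + ‖ys‖ + γ) * δ := by
  have hR0 : 0 ≤ R := (norm_nonneg _).trans hR
  have hL' : 0 ≤ L' := hM.trans hML
  have hnorm : ‖proxGrad f g A M v‖ ≤ R + ‖ys‖ :=
    (norm_le_norm_sub_add _ ys).trans (by gcongr)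
  have hresidual : ‖A (primalX f A (proxGrad f g A M v)) - proxZ f g A M v‖ ≤
      (L' + ‖A‖ ^ 2 / σ) * δ := by
    refine (norm_map_primalX_proxGrad_sub_proxZ_le hf hσ g A hM v).trans ?_
    gcongr
  calc (‖proxGrad f g A M v‖ + γ) * ‖A (primalX f A (proxGrad f g A M v)) - proxZ f g A M v‖
      ≤ (R + ‖ys‖ + γ) * ((L' + ‖A‖ ^ 2 / σ) * δ) := by gcongr
    _ = (L' + ‖A‖ ^ 2 / σ) * (R + ‖ys‖ + γ) * δ := by ring

namespace IsGFDPG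

theorem L_mono (h : IsGFDPG f g A t L y w) : Monotone L :=
  monotone_nat_of_le_succ h.L_le

theorem L_pos (h : IsGFDPG f g A t L y w) (k : ℕ) : 0 < L k :=
  h.L_zero_pos.trans_le (h.L_mono k.zero_le)

theorem all_t_pos (h : IsGFDPG f g A t L y w) (k : ℕ) : 0 < t k := by
  cases k with
  | zero => exact h.t_zero.1
  | succ k => exact h.t_pos k

theorem all_t_sq_le (h : IsGFDPG f g A t L y w) (k : ℕ) : t k ^ 2 ≤ partialT t k := by
  cases k with
  | zero =>
    rw [partialT, Finset.sum_range_one]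
    exact pow_le_of_le_one h.t_zero.1.le h.t_zero.2 two_ne_zero
  | succ k => exact h.t_sq_le k

theorem eq_proxGrad (h : IsGFDPG f g A t L y w) {i : ℕ} (hi : 1 ≤ i) :
    y i = proxGrad f g A (L i) (w (i - 1)) := by
  obtain ⟨j, rfl⟩ := Nat.exists_eq_add_of_le' hi
  exact h.y_succ j

theorem partialT_smul_w (h : IsGFDPG f g A t L y w) (k : ℕ) :
    partialT t k • w k = (∑ i ∈ Finset.range k, t i) • y k + t k • auxSeq t y w k := by
  induction k with
  | zero => simp [partialT, auxSeq, h.w_zero]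
  | succ k ih =>
    have ht := (h.all_t_pos k).ne'
    have hT := (partialT_pos h.all_t_pos (k + 1)).ne'
    have hsum : ∑ i ∈ Finset.range k, t i = partialT t (k + 1) - t (k + 1) - t k := by
      rw [partialT_eq_sum_range_add, Finset.sum_range_succ]
      ring
    have hTk : partialT t k = partialT t (k + 1) - t (k + 1) := by
      rw [partialT_eq_sum_range_add t (k + 1), add_sub_cancel_right, partialT]
    rw [← sub_eq_iff_eq_add', ← inv_smul_eq_iff₀ ht, hsum, hTk] at ih
    rw [auxSeq_succ, ← ih, h.w_succ, ← partialT, hTk]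
    generalize partialT t (k + 1) = T at hT ⊢
    match_scalars <;> field_simp <;> ring

theorem isAcceleratedScheme (h : IsGFDPG f g A t L y w) (hf : IsClosedProperStronglyConvex σ f)
    (hσ : 0 < σ) (hg : IsClosedProperStronglyConvex 0 g) :
    IsAcceleratedScheme (dualObj f g A) t L y w where
  t_pos := h.all_t_pos
  t_sq_le := h.all_t_sq_le
  L_pos := h.L_pos
  L_mono := h.L_mono
  smul_w := h.partialT_smul_w
  descent k := by
    rw [h.y_succ]
    exact (h.backtrack k).isDescentStep hf hσ hg (h.L_pos (k + 1))

theorem isPrimalZ_proxZ (h : IsGFDPG f g A t L y w) (hf : IsClosedProperStronglyConvex σ f)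
    (hσ : 0 < σ) (hg : IsClosedProperStronglyConvex 0 g) {i : ℕ} (hi : 1 ≤ i) :
    IsPrimalZ g (y i) (proxZ f g A (L i) (w (i - 1))) := by
  rw [h.eq_proxGrad hi, isPrimalZ_iff_neg_mem_subdiff]
  exact neg_proxGrad_mem_subdiff_proxZ hf hσ hg A (h.L_pos i) _

theorem min_inf_le (h : IsGFDPG f g A t L y w) (hf : IsClosedProperStronglyConvex σ f)
    (hσ : 0 < σ) (hg : IsClosedProperStronglyConvex 0 g)
    (hys : IsMaxOn (dualFun f g A) Set.univ ys) {k : ℕ} (hk : 1 ≤ k) {L' : ℝ} (hL' : L k ≤ L')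
    (hback : BacktrackCond f g A L' (y k)) {γ : ℝ} (hγ : 0 ≤ γ) {Γ : ℝ → V → EReal}
    (hΓ : ∀ M v, 0 < M → Γ M v ≤ (((‖proxGrad f g A M v‖ + γ)
      * ‖A (primalX f A (proxGrad f g A M v)) - proxZ f g A M v‖ : ℝ) : EReal)) :
    min ((Finset.Icc 1 k).inf fun i => Γ (L i) (w (i - 1))) (Γ L' (y k)) ≤
      (((L' + ‖A‖ ^ 2 / σ) * (‖y 0 - ys‖ + ‖ys‖ + γ)
        * (‖y 0 - ys‖ / √(stepWeight t k)) : ℝ) : EReal) := by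
  have hscheme := h.isAcceleratedScheme hf hσ hg
  have hΦ := isProperFun_dualObj hf hσ hg A
  have hmin := isMinOn_dualObj hf.proper hg.proper hys
  have hL'pos : 0 < L' := (h.L_pos k).trans_le hL'
  have hp := hback.isDescentStep hf hσ hg hL'pos
  rcases hscheme.exists_norm_sub_le hΦ hmin hk hL' hp with ⟨i, hi, hstep⟩ | hstep
  · have hik : i < k := Finset.mem_range.1 hi
    have hdist := hscheme.norm_iterate_sub_le hΦ hmin (i + 1)
    rw [h.y_succ] at hstep hdist
    refine (min_le_left _ _).trans ((Finset.inf_le (b := i + 1) (by simp; lia)).trans ?_)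
    refine (hΓ _ _ (h.L_pos (i + 1))).trans (EReal.coe_le_coe_iff.2 ?_)
    exact norm_proxGrad_add_mul_le hf hσ g A hγ (h.L_pos _).le ((h.L_mono hik).trans hL')
      hdist hstep
  · have hdist := (hp.norm_sub_le hΦ hmin hL'pos).trans (hscheme.norm_iterate_sub_le hΦ hmin k)
    refine (min_le_right _ _).trans ((hΓ _ _ hL'pos).trans (EReal.coe_le_coe_iff.2 ?_))
    exact norm_proxGrad_add_mul_le hf hσ g A hγ hL'pos.le le_rfl hdist hstep

theorem min_inf_splitObj_sub_dualFun_le (h : IsGFDPG f g A t L y w)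
    (hf : IsClosedProperStronglyConvex σ f) (hσ : 0 < σ) (hg : IsClosedProperStronglyConvex 0 g)
    (hys : IsMaxOn (dualFun f g A) Set.univ ys) {k : ℕ} (hk : 1 ≤ k) {L' : ℝ} (hL' : L k ≤ L')
    (hback : BacktrackCond f g A L' (y k)) :
    min
      ((Finset.Icc 1 k).inf fun i =>
        splitObj f g (primalX f A (y i)) (proxZ f g A (L i) (w (i - 1))) - dualFun f g A (y i))
      (splitObj f g (primalX f A (proxGrad f g A L' (y k))) (proxZ f g A L' (y k))
        - dualFun f g A (proxGrad f g A L' (y k))) ≤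
      (((L' + ‖A‖ ^ 2 / σ) * (‖y 0 - ys‖ + ‖ys‖)
        * (‖y 0 - ys‖ / √(stepWeight t k)) : ℝ) : EReal) := by
  have hle := h.min_inf_le hf hσ hg hys hk hL' hback le_rfl
    (Γ := fun M v => splitObj f g (primalX f A (proxGrad f g A M v)) (proxZ f g A M v)
      - dualFun f g A (proxGrad f g A M v)) fun M v hM => by
        rw [add_zero]
        exact splitObj_sub_dualFun_le hf.proper hg.proper (adjoint_mem_subdiff_primalX hf hσ A _)
          (neg_proxGrad_mem_subdiff_proxZ hf hσ hg A hM v)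
  rw [add_zero] at hle
  refine le_of_eq_of_le (congrArg₂ min (Finset.inf_congr rfl fun i hi => ?_) rfl) hle
  rw [h.eq_proxGrad (Finset.mem_Icc.1 hi).1]

theorem min_inf_primalObj_sub_dualFun_le (h : IsGFDPG f g A t L y w)
    (hf : IsClosedProperStronglyConvex σ f) (hσ : 0 < σ) (hg : IsClosedProperStronglyConvex 0 g)
    (hbdd : HasBoundedSubgradients g) (hys : IsMaxOn (dualFun f g A) Set.univ ys) {k : ℕ}
    (hk : 1 ≤ k) {L' : ℝ} (hL' : L k ≤ L') (hback : BacktrackCond f g A L' (y k)) :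
    min
      ((Finset.Icc 1 k).inf fun i => primalObj f g A (primalX f A (y i)) - dualFun f g A (y i))
      (primalObj f g A (primalX f A (proxGrad f g A L' (y k)))
        - dualFun f g A (proxGrad f g A L' (y k))) ≤
      (((L' + ‖A‖ ^ 2 / σ) * (‖y 0 - ys‖ + ‖ys‖ + subgradBound g)
        * (‖y 0 - ys‖ / √(stepWeight t k)) : ℝ) : EReal) := by
  have hle := h.min_inf_le hf hσ hg hys hk hL' hback (subgradBound_nonneg g)
    (Γ := fun M v => primalObj f g A (primalX f A (proxGrad f g A M v))
      - dualFun f g A (proxGrad f g A M v)) fun M v hM =>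
        primalObj_sub_dualFun_le hf.proper hg.proper hbdd (adjoint_mem_subdiff_primalX hf hσ A _)
          (neg_proxGrad_mem_subdiff_proxZ hf hσ hg A hM v)
  refine le_of_eq_of_le (congrArg₂ min (Finset.inf_congr rfl fun i hi => ?_) rfl) hle
  rw [h.eq_proxGrad (Finset.mem_Icc.1 hi).1]

end IsGFDPG

end DualConvergence

theorem mainTheorem1_general {E V : Type*}
    [NormedAddCommGroup E] [InnerProductSpace ℝ E] [CompleteSpace E]
    [NormedAddCommGroup V] [InnerProductSpace ℝ V] [CompleteSpace V]
    (f : E → EReal) (g : V → EReal) (A : E →L[ℝ] V) (σ : ℝ) (hσ : 0 < σ)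
    (hf_proper : IsProperFun f) (hf_closed : LowerSemicontinuous f)
    (hf_conv : IsStronglyConvexFun σ f)
    (hg_proper : IsProperFun g) (hg_closed : LowerSemicontinuous g)
    (hg_conv : IsConvexFun g)
    (yStar : V)
    (hyStar : IsMaxOn (dualFun f g A) Set.univ yStar)
    (a : ℝ) (ha : 2 < a)
    (L : ℕ → ℝ) (y w : ℕ → V)
    (hgen : IsGFDPG f g A (fun k => ((k : ℝ) + a) / a) L y w)
    (k : ℕ) (hk : 1 ≤ k)
    (L' : ℝ) (hL' : L k ≤ L') (hback : BacktrackCond f g A L' (y k)) :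
    ((∀ i ∈ Finset.Icc 1 k, IsPrimalZ g (y i) (proxZ f g A (L i) (w (i - 1)))) ∧
      IsPrimalZ g (proxGrad f g A L' (y k)) (proxZ f g A L' (y k)) ∧
      min
        ((Finset.Icc 1 k).inf fun i =>
          splitObj f g (primalX f A (y i)) (proxZ f g A (L i) (w (i - 1)))
            - dualFun f g A (y i))
        (splitObj f g (primalX f A (proxGrad f g A L' (y k))) (proxZ f g A L' (y k))
          - dualFun f g A (proxGrad f g A L' (y k)))
      ≤ ((a * Real.sqrt 6 / Real.sqrt (a - 2) * (L' + ‖A‖ ^ 2 / σ)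
          * (‖y 0 - yStar‖ + ‖yStar‖) * (‖y 0 - yStar‖ / (k : ℝ) ^ (1.5 : ℝ)) : ℝ) : EReal)) ∧
    (HasBoundedSubgradients g →
      min
        ((Finset.Icc 1 k).inf fun i =>
          primalObj f g A (primalX f A (y i)) - dualFun f g A (y i))
        (primalObj f g A (primalX f A (proxGrad f g A L' (y k)))
          - dualFun f g A (proxGrad f g A L' (y k)))
      ≤ ((a * Real.sqrt 6 / Real.sqrt (a - 2) * (L' + ‖A‖ ^ 2 / σ)
          * (‖y 0 - yStar‖ + ‖yStar‖ + subgradBound g)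
          * (‖y 0 - yStar‖ / (k : ℝ) ^ (1.5 : ℝ)) : ℝ) : EReal)) := by
  have hf : IsClosedProperStronglyConvex σ f := ⟨hf_proper, hf_closed, hf_conv⟩
  have hg : IsClosedProperStronglyConvex 0 g :=
    ⟨hg_proper, hg_closed, hg_conv.isStronglyConvexFun_zero⟩
  have hL'pos : 0 < L' := (hgen.L_pos k).trans_le hL'
  have hrate (C : ℝ) (hC : 0 ≤ C) :
      (L' + ‖A‖ ^ 2 / σ) * C
          * (‖y 0 - yStar‖ / √(stepWeight (fun i => ((i : ℝ) + a) / a) k)) ≤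
        a * √6 / √(a - 2) * (L' + ‖A‖ ^ 2 / σ) * C * (‖y 0 - yStar‖ / (k : ℝ) ^ (1.5 : ℝ)) := by
    calc _ ≤ (L' + ‖A‖ ^ 2 / σ) * C
            * (a * √6 / √(a - 2) * (‖y 0 - yStar‖ / (k : ℝ) ^ (1.5 : ℝ))) := by
          gcongr
          exact div_sqrt_stepWeight_linear_le ha (norm_nonneg _) hk
      _ = _ := by ring
  refine ⟨⟨fun i hi => hgen.isPrimalZ_proxZ hf hσ hg (Finset.mem_Icc.1 hi).1,
    isPrimalZ_iff_neg_mem_subdiff.2 (neg_proxGrad_mem_subdiff_proxZ hf hσ hg A hL'pos _), ?_⟩,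
    fun hbdd => ?_⟩
  · exact (hgen.min_inf_splitObj_sub_dualFun_le hf hσ hg hyStar hk hL' hback).trans
      (EReal.coe_le_coe_iff.2 (hrate _ (by positivity)))
  · exact (hgen.min_inf_primalObj_sub_dualFun_le hf hσ hg hbdd hyStar hk hL' hback).trans
      (EReal.coe_le_coe_iff.2 (hrate _ (by have := subgradBound_nonneg g; positivity)))

theorem mainTheorem1 (n m : ℕ)
    (f : EuclideanSpace ℝ (Fin n) → EReal) (g : EuclideanSpace ℝ (Fin m) → EReal)
    (A : EuclideanSpace ℝ (Fin n) →L[ℝ] EuclideanSpace ℝ (Fin m))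
    (σ : ℝ) (hσ : 0 < σ)
    (hf_proper : IsProperFun f) (hf_closed : LowerSemicontinuous f)
    (hf_conv : IsStronglyConvexFun σ f)
    (hg_proper : IsProperFun g) (hg_closed : LowerSemicontinuous g)
    (hg_conv : IsConvexFun g)
    (yStar : EuclideanSpace ℝ (Fin m))
    (hyStar : IsMaxOn (dualFun f g A) Set.univ yStar)
    (a : ℝ) (ha : 2 < a)
    (L : ℕ → ℝ) (y w : ℕ → EuclideanSpace ℝ (Fin m))
    (hgen : IsGFDPG f g A (fun k => ((k : ℝ) + a) / a) L y w)
    (k : ℕ) (hk : 1 ≤ k)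
    (L' : ℝ) (hL' : L k ≤ L') (hback : BacktrackCond f g A L' (y k)) :
    ((∀ i ∈ Finset.Icc 1 k, IsPrimalZ g (y i) (proxZ f g A (L i) (w (i - 1)))) ∧
      IsPrimalZ g (proxGrad f g A L' (y k)) (proxZ f g A L' (y k)) ∧
      min
        ((Finset.Icc 1 k).inf fun i =>
          splitObj f g (primalX f A (y i)) (proxZ f g A (L i) (w (i - 1)))
            - dualFun f g A (y i))
        (splitObj f g (primalX f A (proxGrad f g A L' (y k))) (proxZ f g A L' (y k))
          - dualFun f g A (proxGrad f g A L' (y k)))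
      ≤ ((a * Real.sqrt 6 / Real.sqrt (a - 2) * (L' + ‖A‖ ^ 2 / σ)
          * (‖y 0 - yStar‖ + ‖yStar‖) * (‖y 0 - yStar‖ / (k : ℝ) ^ (1.5 : ℝ)) : ℝ) : EReal)) ∧
    (HasBoundedSubgradients g →
      min
        ((Finset.Icc 1 k).inf fun i =>
          primalObj f g A (primalX f A (y i)) - dualFun f g A (y i))
        (primalObj f g A (primalX f A (proxGrad f g A L' (y k)))
          - dualFun f g A (proxGrad f g A L' (y k)))
      ≤ ((a * Real.sqrt 6 / Real.sqrt (a - 2) * (L' + ‖A‖ ^ 2 / σ)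
          * (‖y 0 - yStar‖ + ‖yStar‖ + subgradBound g)
          * (‖y 0 - yStar‖ / (k : ℝ) ^ (1.5 : ℝ)) : ℝ) : EReal)) :=
  mainTheorem1_general f g A σ hσ hf_proper hf_closed hf_conv hg_proper hg_closed hg_conv
    yStar hyStar a ha L y w hgen k hk L' hL' hback
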